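/- Let $k:\mathbb R^2\to[0,\infty)$ be a smooth, radially symmetric bump function supported in a ball $B(0,r_0)$, $r_0>0$, with $\int_{\mathbb R^2}k^2\,dx=1$. Let $\xi$ be a white noise on $\mathbb R^2\times[0,\infty)$ (for each $f\in L^2(\mathbb R^2\times[0,\infty))$, the pairing $\langle\xi,f\rangle$ is a centered Gaussian variable of variance $\|f\|_{L^2}^2$, depending linearly on $f$), and for $n\ge 0$ let $$\phi_{0,n}(x)=\int_{\mathbb R^2}\int_{2^{-n-1}}^{1}k\left(\frac{y-x}{t}\right)t^{-3/2}\,\xi(dy,dt),\qquad x\in\mathbb R^2,$$ where a version with continuous sample paths is taken. For $\gamma>0$, let $L_{1,1}^{(n)}$ be the left-right length of the unit square for the Riemannian metric $e^{\gamma\phi_{0,n}}ds^2$ restricted to $[0,1]^2$, that is, $$L_{1,1}^{(n)}=\inf_\pi\int_0^1 e^{\frac{\gamma}{2}\phi_{0,n}(\pi(t))}\,|\pi'(t)|\,dt,$$ the infimum being over all piecewise continuously differentiable paths $\pi:[0,1]\to[0,1]^2$ with $\pi(0)\in\{0\}\times[0,1]$ and $\pi(1)\in\{1\}\times[0,1]$.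 Let $\mu_n=\inf\{l\ge 0:\mathbb P(L_{1,1}^{(n)}\le l)>1/2\}$ be the median of $L_{1,1}^{(n)}$. Then for every $k$ and every $\gamma>0$ there exist constants $c,C>0$, depending only on $k$ and $\gamma$, such that for every $n\ge 0$ and every $x>0$, $$\mathbb P\left(L_{1,1}^{(n)}\le \mu_n e^{-x}\right)\ge c\,e^{-Cx^2}\qquad\text{and}\qquad \mathbb P\left(L_{1,1}^{(n)}\ge \mu_n e^{x}\right)\ge c\,e^{-Cx^2}.$$ -/

import Mathlib

open MeasureTheory ProbabilityTheory Set
open scoped ENNReal NNReal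

/-- The Euclidean plane `ℝ²`. -/
abbrev Plane : Type := EuclideanSpace ℝ (Fin 2)

/-- A smooth, radially symmetric, nonnegative bump function on the plane, supported in the ball
of radius `r₀` about the origin and normalised in `L²`. -/
structure IsBumpFunction (k : Plane → ℝ) (r₀ : ℝ) : Prop where
  smooth : ContDiff ℝ (⊤ : ℕ∞) k
  radial : ∀ x y : Plane, ‖x‖ = ‖y‖ → k x = k y
  nonneg : ∀ x, 0 ≤ k x
  radius_pos : 0 < r₀
  support_subset : Function.support k ⊆ Metric.ball 0 r₀
  normalized : ∫ x, k x ^ 2 = 1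

/-- Lebesgue measure on `ℝ² × [0, ∞)`. -/
noncomputable abbrev halfSpaceMeasure : Measure (Plane × ℝ) :=
  (volume : Measure (Plane × ℝ)).restrict (univ ×ˢ Ici (0 : ℝ))

/-- The space `L²(ℝ² × [0, ∞))`. -/
abbrev L2HalfSpace : Type := Lp ℝ 2 halfSpaceMeasure

/-- White noise on `ℝ² × [0, ∞)`, given through its pairings `f ↦ ⟨ξ, f⟩` with square-integrable
functions: a linear map into `L²(Ω, P)` such that each `⟨ξ, f⟩` is a centred Gaussian variable of
variance `‖f‖²`. -/
structure IsWhiteNoise {Ω : Type*} [MeasurableSpace Ω] (P : Measure Ω)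
    (ξ : L2HalfSpace →ₗ[ℝ] Lp ℝ 2 P) : Prop where
  map_eq_gaussianReal : ∀ f : L2HalfSpace, P.map (ξ f) = gaussianReal 0 (‖f‖₊ ^ 2)

/-- The function `(y, t) ↦ k((y - x) / t) t^{-3/2} 𝟙{2^{-n-1} ≤ t ≤ 2^{-m}}`. -/
noncomputable def scaleKernel (k : Plane → ℝ) (m n : ℕ) (x : Plane) : Plane × ℝ → ℝ :=
  (univ ×ˢ Icc ((1 / 2 : ℝ) ^ (n + 1)) ((1 / 2 : ℝ) ^ m)).indicator
    fun p => k (p.2⁻¹ • (p.1 - x)) * p.2 ^ (-(3 : ℝ) / 2)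

theorem IsBumpFunction.memLp_scaleKernel {k : Plane → ℝ} {r₀ : ℝ} (hk : IsBumpFunction k r₀)
    (m n : ℕ) (x : Plane) : MemLp (scaleKernel k m n x) 2 halfSpaceMeasure := by
  set a : ℝ := (1 / 2 : ℝ) ^ (n + 1) with ha
  set b : ℝ := (1 / 2 : ℝ) ^ m with hb
  have ha0 : 0 < a := by positivity
  have hb0 : 0 < b := by positivity
  have hr := hk.radius_pos
  have hcs : HasCompactSupport k :=
    HasCompactSupport.of_support_subset_isCompact (isCompact_closedBall (0 : Plane) r₀)
      (hk.support_subset.trans Metric.ball_subset_closedBall)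
  obtain ⟨M, hM⟩ := hcs.exists_bound_of_continuous hk.smooth.continuous
  have hmeas : Measurable (scaleKernel k m n x) := by
    unfold scaleKernel
    refine Measurable.indicator ?_ (MeasurableSet.univ.prod measurableSet_Icc)
    have := hk.smooth.continuous.measurable
    fun_prop
  set K : Set (Plane × ℝ) := Metric.closedBall x (b * r₀) ×ˢ Icc a b with hK
  have hKm : MeasurableSet K := Metric.isClosed_closedBall.measurableSet.prod measurableSet_Icc
  have hKfin : halfSpaceMeasure K ≠ ∞ := by
    refine ne_top_of_le_ne_top ?_ (Measure.restrict_apply_le _ _)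
    exact ((isCompact_closedBall x (b * r₀)).prod isCompact_Icc).measure_lt_top.ne
  refine MemLp.of_le (g := K.indicator fun _ => M * a ^ (-(3 : ℝ) / 2))
    (memLp_indicator_const 2 hKm _ (Or.inr hKfin)) hmeas.aestronglyMeasurable
    (Filter.Eventually.of_forall fun p => ?_)
  by_cases hp : p ∈ (univ : Set Plane) ×ˢ Icc a b
  · have hpt : a ≤ p.2 ∧ p.2 ≤ b := hp.2
    have ht0 : 0 < p.2 := ha0.trans_le hpt.1
    have e1 : scaleKernel k m n x p = k (p.2⁻¹ • (p.1 - x)) * p.2 ^ (-(3 : ℝ) / 2) :=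
      indicator_of_mem hp _
    by_cases hz : k (p.2⁻¹ • (p.1 - x)) = 0
    · simp [e1, hz]
    · have hball := hk.support_subset hz
      rw [mem_ball_zero_iff, norm_smul, norm_inv, Real.norm_of_nonneg ht0.le,
        inv_mul_lt_iff₀ ht0] at hball
      have hpK : p ∈ K := by
        refine ⟨?_, hpt⟩
        rw [Metric.mem_closedBall, dist_eq_norm]
        exact hball.le.trans (mul_le_mul_of_nonneg_right hpt.2 hr.le)
      have hM0 : 0 ≤ M := (norm_nonneg _).trans (hM 0)
      rw [e1, indicator_of_mem hpK, norm_mul, Real.norm_of_nonneg (Real.rpow_nonneg ht0.le _)]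
      refine le_trans ?_ (le_abs_self _)
      exact mul_le_mul (hM _) (Real.rpow_le_rpow_of_nonpos ha0 hpt.1 (by norm_num))
        (Real.rpow_nonneg ht0.le _) hM0
  · have e1 : scaleKernel k m n x p = 0 := indicator_of_notMem hp _
    simp [e1]

/-- `φ` is the Gaussian field
`φ_{m,n}(x) = ∫_{ℝ²} ∫_{2^{-n-1}}^{2^{-m}} k((y - x) / t) t^{-3/2} ξ(dy, dt)`.
The white-noise integral determines each `φ_{m,n}(x)` almost surely; as usual, the field is a
version of it with continuous sample paths. -/
structure IsScaleField {k : Plane → ℝ} {r₀ : ℝ} (hk : IsBumpFunction k r₀)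
    {Ω : Type*} [MeasurableSpace Ω] {P : Measure Ω} (ξ : L2HalfSpace →ₗ[ℝ] Lp ℝ 2 P)
    (m n : ℕ) (φ : Plane → Ω → ℝ) : Prop where
  ae_eq : ∀ x, φ x =ᵐ[P] ξ (hk.memLp_scaleKernel m n x).toLp
  continuous_paths : ∀ᵐ ω ∂P, Continuous fun x => φ x ω

/-- The rectangle `[0, a] × [0, b]`. -/
def rectangle (a b : ℝ) : Set Plane := {z | z 0 ∈ Icc 0 a ∧ z 1 ∈ Icc 0 b}

/-- `π : [0, 1] → ℝ²` is continuous and, for some finite set `S` of break points, is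
continuously differentiable on every closed subinterval with no point of `S` in its interior. -/
def IsPiecewiseC1 (π : ℝ → Plane) : Prop :=
  ContinuousOn π (Icc 0 1) ∧ ∃ S : Finset ℝ, ∀ s t : ℝ, 0 ≤ s → s < t → t ≤ 1 →
    (∀ u ∈ S, u ∉ Ioo s t) → ContDiffOn ℝ 1 π (Icc s t)

/-- Piecewise `C¹` paths inside `[0, a] × [0, b]` from its left side to its right side. -/
def IsLeftRightCrossing (a b : ℝ) (π : ℝ → Plane) : Prop :=
  IsPiecewiseC1 π ∧ (∀ t ∈ Icc (0 : ℝ) 1, π t ∈ rectangle a b) ∧ π 0 0 = 0 ∧ π 1 0 = a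

/-- Length of `π : [0, 1] → ℝ²` for the Riemannian metric `e^{γ f} ds²`. -/
noncomputable def riemannianLength (γ : ℝ) (f : Plane → ℝ) (π : ℝ → Plane) : ℝ :=
  ∫ t in (0 : ℝ)..1, Real.exp (γ / 2 * f (π t)) * ‖deriv π t‖

/-- Left-right length of `[0, a] × [0, b]` for the Riemannian metric `e^{γ f} ds²` restricted to
`[0, a] × [0, b]`. -/
noncomputable def leftRightLength (γ a b : ℝ) (f : Plane → ℝ) : ℝ :=
  sInf (riemannianLength γ f '' {π | IsLeftRightCrossing a b π})

/-- The `p`-th quantile `inf {l ≥ 0 | P(X ≤ l) > p}` of a nonnegative random variable. -/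
noncomputable def quantile {Ω : Type*} [MeasurableSpace Ω] (P : Measure Ω) (X : Ω → ℝ)
    (p : ℝ) : ℝ :=
  sInf {l : ℝ | 0 ≤ l ∧ p < P.real {ω | X ω ≤ l}}

/-- The median of a nonnegative random variable. -/
noncomputable def median {Ω : Type*} [MeasurableSpace Ω] (P : Measure Ω) (X : Ω → ℝ) : ℝ :=
  quantile P X (1 / 2)

/-! ### Left-right lengths -/

/-! The law of the length has Gaussian-size tails because the field contains an independent Gaussian
constant. Let `g` be a normalised indicator of a large ball times the scales `[1/2, 1]`. These
scales occur in every `φ_{0,n}`, and the kernels at different points are translates of one another,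
so `⟨g, kernel at x⟩` is one constant `a > 0` for all `n` and all `x` in the square
(`exists_unit_inner_scaleKernel`).

Hence `φ = a Z + X` on the square, with `Z = ξ g` standard Gaussian. `X` is uncorrelated with `Z`
and jointly Gaussian with it, so independent of it. A constant added to the field factors out of the
length, so `L = e^{σ Z} Y` with `σ = γ a / 2` and `Y` independent of `Z`
(`exists_leftRightLength_factorization`).

Moving `Z` by `±x/σ` multiplies `L` by `e^{±x}`. Each of the events `L ≤ median` and `L ≥ median`
has probability at least `1/2`, and a shift by `s` leaves at least `e^{-(2 + s²)} / 4` of it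
(`le_measureReal_gaussian_shift`). -/

theorem riemannianLength_nonneg (γ : ℝ) (f : Plane → ℝ) (π : ℝ → Plane) :
    0 ≤ riemannianLength γ f π :=
  intervalIntegral.integral_nonneg zero_le_one fun _ _ => by positivity

theorem leftRightLength_nonneg (γ a b : ℝ) (f : Plane → ℝ) : 0 ≤ leftRightLength γ a b f :=
  Real.sInf_nonneg (by rintro _ ⟨π, -, rfl⟩; exact riemannianLength_nonneg γ f π)

theorem riemannianLength_le_of_le_add {γ a b ε : ℝ} (hγ : 0 ≤ γ) {f g : Plane → ℝ}
    (hf : ContinuousOn f (rectangle a b)) (hg : ContinuousOn g (rectangle a b))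
    (h : ∀ z ∈ rectangle a b, f z ≤ g z + ε) {π : ℝ → Plane} (hπ : IsLeftRightCrossing a b π) :
    riemannianLength γ f π ≤ Real.exp (γ / 2 * ε) * riemannianLength γ g π := by
  have hweight : ∀ {u : Plane → ℝ}, ContinuousOn u (rectangle a b) → ∀ c : ℝ,
      ContinuousOn (fun t => Real.exp (c * u (π t))) (uIcc 0 1) := fun hu c => by
    rw [uIcc_of_le zero_le_one]
    exact Real.continuous_exp.comp_continuousOn
      (continuousOn_const.mul (hu.comp hπ.1.1 hπ.2.1))
  unfold riemannianLength
  by_cases hint : IntervalIntegrable (fun t => ‖deriv π t‖) volume 0 1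
  · rw [← intervalIntegral.integral_const_mul]
    refine intervalIntegral.integral_mono_on zero_le_one
      (hint.continuousOn_mul (hweight hf _))
      ((hint.continuousOn_mul (hweight hg _)).const_mul _) fun t ht => ?_
    rw [← mul_assoc, ← Real.exp_add, ← mul_add, add_comm ε]
    have := h _ (hπ.2.1 t ht)
    gcongr
  -- If the speed is not integrable, neither is the weighted speed, since the weight has a
  -- continuous inverse; the length on the left then takes the default value 0.
  · rw [intervalIntegral.integral_undef]
    · exact mul_nonneg (Real.exp_pos _).le (riemannianLength_nonneg γ g π)
    · intro hc
      refine hint ((hc.continuousOn_mul (hweight hf (-(γ / 2)))).congr fun t _ => ?_)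
      simp only [← mul_assoc, ← Real.exp_add]
      simp

theorem leftRightLength_le_of_le_add {γ a b ε : ℝ} (hγ : 0 ≤ γ) {f g : Plane → ℝ}
    (hf : ContinuousOn f (rectangle a b)) (hg : ContinuousOn g (rectangle a b))
    (h : ∀ z ∈ rectangle a b, f z ≤ g z + ε) :
    leftRightLength γ a b f ≤ Real.exp (γ / 2 * ε) * leftRightLength γ a b g := by
  unfold leftRightLength
  rcases Set.eq_empty_or_nonempty {π | IsLeftRightCrossing a b π} with he | hne
  -- Without crossings both infima are `sInf ∅ = 0`.
  · simp [he]
  rw [mul_comm, ← div_le_iff₀ (Real.exp_pos _)]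
  refine le_csInf (hne.image _) ?_
  rintro _ ⟨π, hπ, rfl⟩
  rw [div_le_iff₀ (Real.exp_pos _), mul_comm]
  refine (csInf_le ⟨0, ?_⟩ (mem_image_of_mem _ hπ)).trans
    (riemannianLength_le_of_le_add hγ hf hg h hπ)
  rintro _ ⟨π', -, rfl⟩
  exact riemannianLength_nonneg γ f π'

/-- Adding a constant to the field multiplies the left-right length. -/
theorem leftRightLength_eq_of_eq_add {γ a b c : ℝ} (hγ : 0 ≤ γ) {f g : Plane → ℝ}
    (hf : ContinuousOn f (rectangle a b)) (hg : ContinuousOn g (rectangle a b))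
    (h : ∀ z ∈ rectangle a b, f z = g z + c) :
    leftRightLength γ a b f = Real.exp (γ / 2 * c) * leftRightLength γ a b g := by
  refine le_antisymm (leftRightLength_le_of_le_add hγ hf hg fun z hz => (h z hz).le) ?_
  have := leftRightLength_le_of_le_add (ε := -c) hγ hg hf fun z hz => by linarith [h z hz]
  calc _ ≤ Real.exp (γ / 2 * c) * (Real.exp (γ / 2 * -c) * leftRightLength γ a b f) := by gcongr
    _ = leftRightLength γ a b f := by rw [← mul_assoc, ← Real.exp_add]; simp

theorem isCompact_rectangle (a b : ℝ) : IsCompact (rectangle a b) := by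
  have : rectangle a b = (EuclideanSpace.equiv (Fin 2) ℝ).toHomeomorph ⁻¹'
      (univ.pi ![Icc 0 a, Icc 0 b]) := by
    ext z; simp [rectangle, Fin.forall_fin_two]
  rw [this, Homeomorph.isCompact_preimage]
  exact isCompact_univ_pi fun i => by fin_cases i <;> exact isCompact_Icc

instance (a b : ℝ) : CompactSpace (rectangle a b) :=
  isCompact_iff_compactSpace.mp (isCompact_rectangle a b)

open Classical in
/-- Extension by zero of a function on the rectangle. -/
noncomputable def extendRectangle {a b : ℝ} (g : rectangle a b → ℝ) (z : Plane) : ℝ :=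
  if h : z ∈ rectangle a b then g ⟨z, h⟩ else 0

theorem extendRectangle_of_mem {a b : ℝ} (g : rectangle a b → ℝ) {z : Plane}
    (h : z ∈ rectangle a b) : extendRectangle g z = g ⟨z, h⟩ := dif_pos h

theorem continuousOn_extendRectangle {a b : ℝ} (g : C(rectangle a b, ℝ)) :
    ContinuousOn (extendRectangle g) (rectangle a b) := by
  rw [continuousOn_iff_continuous_domRestrict]
  convert g.continuous using 1
  ext z
  exact extendRectangle_of_mem _ z.2

/-- Fields at sup-distance `d` have lengths within a factor `e^{γ d / 2}` of each other. Continuity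
makes the length of a random field measurable and lets it inherit independence. -/
theorem continuous_leftRightLength_extendRectangle {γ : ℝ} (hγ : 0 ≤ γ) (a b : ℝ) :
    Continuous fun g : C(rectangle a b, ℝ) => leftRightLength γ a b (extendRectangle g) := by
  have key : ∀ f g : C(rectangle a b, ℝ), leftRightLength γ a b (extendRectangle f) ≤
      Real.exp (γ / 2 * dist f g) * leftRightLength γ a b (extendRectangle g) := fun f g =>
    leftRightLength_le_of_le_add hγ (continuousOn_extendRectangle f)
      (continuousOn_extendRectangle g) fun z hz => by
        rw [extendRectangle_of_mem _ hz, extendRectangle_of_mem _ hz]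
        have := (abs_le.mp ((Real.dist_eq _ _).symm.trans_le
          (ContinuousMap.dist_apply_le_dist (f := f) (g := g) ⟨z, hz⟩))).2
        linarith
  rw [continuous_iff_continuousAt]
  intro f
  set l := leftRightLength γ a b (extendRectangle f)
  have hlim : ∀ c : ℝ, Filter.Tendsto (fun g => Real.exp (c * dist g f) * l) (nhds f)
      (nhds l) := fun c => by
    have : Continuous fun g : C(rectangle a b, ℝ) => Real.exp (c * dist g f) * l := by fun_prop
    simpa using this.tendsto f
  refine tendsto_of_tendsto_of_tendsto_of_le_of_le (hlim (-(γ / 2))) (hlim (γ / 2))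
    (fun g => ?_) (fun g => key g f)
  have h1 := key f g
  rw [dist_comm] at h1
  calc Real.exp (-(γ / 2) * dist g f) * l ≤ Real.exp (-(γ / 2) * dist g f) *
        (Real.exp (γ / 2 * dist g f) * leftRightLength γ a b (extendRectangle g)) := by gcongr
    _ = leftRightLength γ a b (extendRectangle g) := by
        rw [← mul_assoc, ← Real.exp_add]; simp

/-! ### Random continuous functions -/

theorem measurable_of_measurable_dist {α E : Type*} [MeasurableSpace α] [PseudoMetricSpace E]
    [SecondCountableTopology E] [MeasurableSpace E] [BorelSpace E] {X : α → E}
    (h : ∀ g, Measurable fun a => dist (X a) g) : Measurable X := by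
  have hb : borel E = MeasurableSpace.generateFrom {s : Set E | ∃ g r, s = Metric.ball g r} := by
    refine TopologicalSpace.IsTopologicalBasis.borel_eq_generateFrom
      (TopologicalSpace.isTopologicalBasis_of_isOpen_of_nhds ?_ fun x u hx hu => ?_)
    · rintro _ ⟨g, r, rfl⟩
      exact Metric.isOpen_ball
    · obtain ⟨r, hr, hs⟩ := Metric.isOpen_iff.mp hu x hx
      exact ⟨_, ⟨x, r, rfl⟩, Metric.mem_ball_self hr, hs⟩
  rw [BorelSpace.measurable_eq (α := E), hb]
  refine measurable_generateFrom ?_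
  rintro _ ⟨g, r, rfl⟩
  exact h g measurableSet_Iio

/-- A map into `C(K, ℝ)` is Borel measurable as soon as all its evaluations are measurable. -/
theorem ContinuousMap.measurable_of_measurable_eval {α K : Type*} [MeasurableSpace α]
    [MetricSpace K] [CompactSpace K] [MeasurableSpace C(K, ℝ)] [BorelSpace C(K, ℝ)]
    {X : α → C(K, ℝ)} (h : ∀ z, Measurable fun a => X a z) : Measurable X := by
  refine measurable_of_measurable_dist fun g => measurable_of_Iic fun r => ?_
  rcases lt_or_ge r 0 with hr | hr
  · convert MeasurableSet.empty
    exact eq_empty_of_forall_notMem fun a ha => absurd (dist_nonneg.trans ha) (not_le.mpr hr)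
  obtain ⟨D, hDc, hDd⟩ := TopologicalSpace.exists_countable_dense K
  have : (fun a => dist (X a) g) ⁻¹' Iic r = ⋂ z ∈ D, {a | dist (X a z) (g z) ≤ r} := by
    ext a
    simp only [mem_preimage, mem_Iic, mem_iInter, mem_ofPred_eq]
    rw [ContinuousMap.dist_le hr]
    refine ⟨fun H z _ => H z, fun H z => ?_⟩
    have hc : IsClosed {z | dist (X a z) (g z) ≤ r} := isClosed_le (by fun_prop) (by fun_prop)
    exact hc.closure_subset_iff.mpr H (hDd z)
  rw [this]
  refine MeasurableSet.biInter hDc fun z _ => ?_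
  exact measurableSet_le ((h z).dist measurable_const) measurable_const

theorem ContinuousMap.aemeasurable_of_aemeasurable_eval {α K : Type*} [MeasurableSpace α]
    {P : Measure α} [MetricSpace K] [CompactSpace K] [MeasurableSpace C(K, ℝ)]
    [BorelSpace C(K, ℝ)] {X : α → C(K, ℝ)} (h : ∀ z, AEMeasurable (fun a => X a z) P) :
    AEMeasurable X P := by
  -- The measurable statement is applied over the completed σ-algebra.
  have : NullMeasurable X P :=
    (measurable_of_measurable_eval (α := NullMeasurableSpace α P)
      fun z _ hs => (h z).nullMeasurable hs : Measurable (α := NullMeasurableSpace α P) X)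
  exact this.aemeasurable

/-- Independence from all evaluations gives independence from the random function. -/
theorem ContinuousMap.indepFun_of_indepFun_eval {α β K : Type*} [MeasurableSpace α]
    [MeasurableSpace β] {P : Measure α} [MetricSpace K] [CompactSpace K]
    [MeasurableSpace C(K, ℝ)] [BorelSpace C(K, ℝ)] {Z : α → β} {X : α → C(K, ℝ)}
    (h : IndepFun Z (fun a z => X a z) P) : IndepFun Z X P := by
  rw [IndepFun_iff_Indep] at h ⊢
  have hX : @Measurable α C(K, ℝ) (MeasurableSpace.comap (fun a z => X a z) inferInstance) _ X :=
    @ContinuousMap.measurable_of_measurable_eval α K (_) _ _ _ _ X fun z =>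
      (measurable_pi_apply z).comp (comap_measurable fun a z => X a z)
  exact indep_of_indep_of_le_right h hX.comap_le

/-! ### White noise -/

namespace IsWhiteNoise

variable {Ω : Type*} [MeasurableSpace Ω] {P : Measure Ω} {ξ : L2HalfSpace →ₗ[ℝ] Lp ℝ 2 P}

variable (ξ) in
theorem aemeasurable (f : L2HalfSpace) : AEMeasurable (ξ f) P :=
  (Lp.aestronglyMeasurable (ξ f)).aemeasurable

theorem integral_eq_zero (h : IsWhiteNoise P ξ) (f : L2HalfSpace) : ∫ ω, ξ f ω ∂P = 0 := by
  have := integral_map (aemeasurable ξ f) (f := id) (by fun_prop) (μ := P)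
  rw [h.map_eq_gaussianReal] at this
  simpa using this.symm

theorem norm_apply (h : IsWhiteNoise P ξ) (f : L2HalfSpace) : ‖ξ f‖ = ‖f‖ := by
  have h1 := variance_map (X := id) (Y := ξ f) (μ := P) (by fun_prop) (aemeasurable ξ f)
  rw [h.map_eq_gaussianReal, variance_id_gaussianReal, Function.id_comp,
    variance_of_integral_eq_zero (aemeasurable ξ f) (h.integral_eq_zero f)] at h1
  have h2 : ‖ξ f‖ ^ 2 = ∫ ω, ξ f ω ^ 2 ∂P := by
    rw [← real_inner_self_eq_norm_sq, L2.inner_def]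
    simp [pow_two]
  rw [← h1] at h2
  simpa using h2

/-- Prescribed variances make `ξ` a linear isometry, and polarisation recovers inner products. -/
theorem inner_apply (h : IsWhiteNoise P ξ) (f g : L2HalfSpace) :
    inner ℝ (ξ f) (ξ g) = inner ℝ f g :=
  (⟨ξ, h.norm_apply⟩ : L2HalfSpace →ₗᵢ[ℝ] Lp ℝ 2 P).inner_map_map f g

theorem covariance_eq_inner [IsProbabilityMeasure P] (h : IsWhiteNoise P ξ)
    (f g : L2HalfSpace) : cov[ξ f, ξ g; P] = inner ℝ f g := by
  rw [covariance_eq_sub (Lp.memLp _) (Lp.memLp _), h.integral_eq_zero, zero_mul, sub_zero,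
    ← h.inner_apply, L2.inner_def]
  exact integral_congr_ae (ae_of_all _ fun ω => mul_comm _ _)

/-- Any linear combination of pairings is, almost surely, a single pairing by linearity of `ξ`,
hence Gaussian. -/
theorem isGaussianProcess (h : IsWhiteNoise P ξ) :
    IsGaussianProcess (fun f ω => ξ f ω) P where
  hasGaussianLaw I := by
    have hm : AEMeasurable (fun ω => I.restrict fun f => ξ f ω) P :=
      aemeasurable_pi_lambda _ fun i => aemeasurable ξ i.1
    refine ⟨isGaussian_of_map_eq_gaussianReal fun l => ?_⟩
    classical
    refine ⟨0, ‖∑ i : I, l (Pi.single i 1) • (i : L2HalfSpace)‖₊ ^ 2, ?_⟩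
    rw [← h.map_eq_gaussianReal, AEMeasurable.map_map_of_aemeasurable (by fun_prop) hm]
    refine Measure.map_congr ?_
    have hsum : ∀ᵐ ω ∂P, ξ (∑ i : I, l (Pi.single i 1) • (i : L2HalfSpace)) ω =
        ∑ i : I, l (Pi.single i 1) * ξ i ω := by
      rw [map_sum]
      have h1 := Lp.coeFn_finsetSum (μ := P) Finset.univ
        fun i : I => ξ (l (Pi.single i 1) • (i : L2HalfSpace))
      have h2 : ∀ᵐ ω ∂P, ∀ i : I, ξ (l (Pi.single i 1) • (i : L2HalfSpace)) ω =
          l (Pi.single i 1) * ξ i ω := ae_all_iff.mpr fun i => by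
        rw [map_smul]
        filter_upwards [Lp.coeFn_smul (l (Pi.single i 1)) (ξ i)] with ω hω
        simpa using hω
      filter_upwards [h1, h2] with ω e1 e2
      rw [e1, Finset.sum_apply]
      exact Finset.sum_congr rfl fun i _ => e2 i
    filter_upwards [hsum] with ω hω
    rw [hω, Function.comp_apply]
    conv_lhs => rw [← Finset.univ_sum_single (I.restrict fun f => ξ f ω), map_sum]
    refine Finset.sum_congr rfl fun i _ => ?_
    have hs : Pi.single i (I.restrict (fun f => ξ f ω) i) =
        ξ i ω • (Pi.single i 1 : I → ℝ) := by
      rw [← Pi.single_smul, smul_eq_mul, mul_one]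
      rfl
    rw [hs, map_smul, smul_eq_mul, mul_comm]

end IsWhiteNoise

/-! ### A Cameron–Martin direction that is constant on a ball -/

instance : (volume : Measure (Plane × ℝ)).IsAddHaarMeasure :=
  inferInstanceAs ((volume : Measure Plane).prod (volume : Measure ℝ)).IsAddHaarMeasure

/-- The cylinder `B̄(0, R) × [1/2, 1]`. -/
def scaleCylinder (R : ℝ) : Set (Plane × ℝ) := Metric.closedBall 0 R ×ˢ Icc (1 / 2) 1

theorem isCompact_scaleCylinder (R : ℝ) : IsCompact (scaleCylinder R) :=
  (isCompact_closedBall 0 R).prod isCompact_Icc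

theorem measurableSet_scaleCylinder (R : ℝ) : MeasurableSet (scaleCylinder R) :=
  (isCompact_scaleCylinder R).isClosed.measurableSet

theorem halfSpaceMeasure_scaleCylinder_ne_top (R : ℝ) :
    halfSpaceMeasure (scaleCylinder R) ≠ ∞ :=
  ne_top_of_le_ne_top (isCompact_scaleCylinder R).measure_lt_top.ne (Measure.restrict_apply_le _ _)

theorem scaleCylinder_subset_univ_prod_Ici (R : ℝ) :
    scaleCylinder R ⊆ univ ×ˢ Ici (0 : ℝ) :=
  fun _ hp => ⟨mem_univ _, le_trans (by norm_num) hp.2.1⟩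

/-- The scales `[1/2, 1]` are present for every `n`, and at scales `t ≤ 1` the kernel lives within
`r₀` of `x`, so cutting off at radius `R` removes nothing there. -/
theorem indicator_scaleCylinder_scaleKernel {k : Plane → ℝ} {r₀ : ℝ} (hk : IsBumpFunction k r₀)
    (n : ℕ) {x : Plane} {R : ℝ} (hx : ‖x‖ + r₀ ≤ R) (p : Plane × ℝ) :
    (scaleCylinder R).indicator (scaleKernel k 0 n x) p = scaleKernel k 0 0 0 (p - (x, 0)) := by
  have hn : (1 / 2 : ℝ) ^ (n + 1) ≤ 1 / 2 := pow_le_of_le_one (by norm_num) (by norm_num) (by simp)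
  by_cases ht : p.2 ∈ Icc (1 / 2 : ℝ) 1
  · have h0 : scaleKernel k 0 0 0 (p - (x, 0)) =
        k (p.2⁻¹ • (p.1 - x)) * p.2 ^ (-(3 : ℝ) / 2) := by
      rw [scaleKernel, indicator_of_mem]
      · simp
      · exact ⟨mem_univ _, by simpa using ht⟩
    have h1 : scaleKernel k 0 n x p = k (p.2⁻¹ • (p.1 - x)) * p.2 ^ (-(3 : ℝ) / 2) :=
      indicator_of_mem (show p ∈ univ ×ˢ Icc ((1 / 2 : ℝ) ^ (n + 1)) ((1 / 2 : ℝ) ^ 0) from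
        ⟨mem_univ _, hn.trans ht.1, by simpa using ht.2⟩) _
    rw [h0, ← h1]
    by_cases hp : p.1 ∈ Metric.closedBall (0 : Plane) R
    · exact indicator_of_mem (show p ∈ scaleCylinder R from ⟨hp, ht⟩) _
    · rw [indicator_of_notMem fun h => hp h.1, h1]
      have : k (p.2⁻¹ • (p.1 - x)) = 0 := by
        by_contra hz
        have ht0 : 0 < p.2 := lt_of_lt_of_le (by norm_num) ht.1
        have hball := hk.support_subset hz
        rw [mem_ball_zero_iff, norm_smul, norm_inv, Real.norm_of_nonneg ht0.le,
          inv_mul_lt_iff₀ ht0] at hball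
        have h2 : p.2 * r₀ ≤ r₀ := mul_le_of_le_one_left hk.radius_pos.le ht.2
        have h3 : ‖p.1‖ ≤ ‖p.1 - x‖ + ‖x‖ := norm_le_norm_sub_add _ _
        exact hp (mem_closedBall_zero_iff.mpr (by linarith))
      rw [this, zero_mul]
  · rw [indicator_of_notMem fun h => ht h.2, scaleKernel, indicator_of_notMem]
    exact fun h => ht (by simpa using h.2)

theorem setIntegral_scaleKernel {k : Plane → ℝ} {r₀ : ℝ} (hk : IsBumpFunction k r₀)
    (n : ℕ) {x : Plane} {R : ℝ} (hx : ‖x‖ + r₀ ≤ R) :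
    ∫ p in scaleCylinder R, scaleKernel k 0 n x p ∂halfSpaceMeasure =
      ∫ p, scaleKernel k 0 0 0 p := by
  rw [Measure.restrict_restrict_of_subset (scaleCylinder_subset_univ_prod_Ici R),
    ← integral_indicator (measurableSet_scaleCylinder R),
    ← integral_sub_right_eq_self (scaleKernel k 0 0 0) ((x, 0) : Plane × ℝ)]
  exact integral_congr_ae (ae_of_all _ (indicator_scaleCylinder_scaleKernel hk n hx))

theorem IsBumpFunction.exists_ne_zero {k : Plane → ℝ} {r₀ : ℝ} (hk : IsBumpFunction k r₀) :
    ∃ y, k y ≠ 0 := by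
  by_contra! h
  simpa [h] using hk.normalized

theorem integral_scaleKernel_pos {k : Plane → ℝ} {r₀ : ℝ} (hk : IsBumpFunction k r₀) :
    0 < ∫ p, scaleKernel k 0 0 0 p := by
  rw [← setIntegral_scaleKernel hk 0 (x := 0) (R := r₀) (by simp)]
  have hint : IntegrableOn (scaleKernel k 0 0 0) (scaleCylinder r₀) halfSpaceMeasure := by
    have : IsFiniteMeasure (halfSpaceMeasure.restrict (scaleCylinder r₀)) :=
      ⟨by simpa using (halfSpaceMeasure_scaleCylinder_ne_top r₀).lt_top⟩
    exact ((hk.memLp_scaleKernel 0 0 0).restrict _).integrable (by norm_num)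
  have hnn : ∀ p, 0 ≤ scaleKernel k 0 0 0 p := fun p => by
    refine indicator_nonneg (fun q hq => ?_) p
    have : 0 ≤ q.2 := le_trans (by positivity) hq.2.1
    exact mul_nonneg (hk.nonneg _) (Real.rpow_nonneg this _)
  rw [setIntegral_pos_iff_support_of_nonneg_ae (ae_of_all _ hnn) hint,
    Measure.restrict_apply' (
      MeasurableSet.univ.prod measurableSet_Ici)]
  obtain ⟨y, hy⟩ := hk.exists_ne_zero
  let U : Set (Plane × ℝ) := {p | p.2 ∈ Ioo (1 / 2 : ℝ) 1 ∧ k (p.2⁻¹ • p.1) ≠ 0}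
  have hU : IsOpen U := by
    rw [isOpen_iff_mem_nhds]
    rintro p ⟨hp, hkp⟩
    have hc : ContinuousAt (fun p : Plane × ℝ => k (p.2⁻¹ • p.1)) p :=
      hk.smooth.continuous.continuousAt.comp
        ((continuousAt_snd.inv₀ (by have := hp.1; positivity)).smul continuousAt_fst)
    exact Filter.inter_mem (continuousAt_snd (isOpen_Ioo.mem_nhds hp)) (hc.eventually_ne hkp)
  have hUne : U.Nonempty := ⟨((3 / 4 : ℝ) • y, 3 / 4), by norm_num, by simpa [smul_smul] using hy⟩
  refine (hU.measure_pos volume hUne).trans_le (measure_mono fun p hp => ?_)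
  have hp2 : 0 < p.2 := lt_trans (by norm_num) hp.1.1
  have hpI : p ∈ univ ×ˢ Icc ((1 / 2 : ℝ) ^ (0 + 1)) ((1 / 2 : ℝ) ^ 0) :=
    ⟨mem_univ _, by simpa using hp.1.1.le, by simpa using hp.1.2.le⟩
  have hne : scaleKernel k 0 0 0 p ≠ 0 := by
    rw [scaleKernel, indicator_of_mem hpI, sub_zero]
    exact mul_ne_zero hp.2 (Real.rpow_pos_of_pos hp2 _).ne'
  refine ⟨⟨hne, ?_⟩, mem_univ _, hp2.le⟩
  -- Outside the cylinder the cut-off identity at `x = 0` forces the kernel to vanish.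
  by_contra hc
  have := indicator_scaleCylinder_scaleKernel hk 0 (x := 0) (R := r₀) (by simp) p
  rw [indicator_of_notMem hc, Prod.mk_zero_zero, sub_zero] at this
  exact hne this.symm

/-- There is a unit vector of `L²` whose inner product with the kernel of `φ_{0,n}(x)` is the same
positive constant for all `n` and all `x` in a given ball. -/
theorem exists_unit_inner_scaleKernel {k : Plane → ℝ} {r₀ : ℝ} (hk : IsBumpFunction k r₀)
    (R : ℝ) : ∃ (g : L2HalfSpace) (a : ℝ), ‖g‖ = 1 ∧ 0 < a ∧ ∀ (n : ℕ) (x : Plane), ‖x‖ ≤ R →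
      inner ℝ g (hk.memLp_scaleKernel 0 n x).toLp = a := by
  set I := ∫ p, scaleKernel k 0 0 0 p
  have hI : 0 < I := integral_scaleKernel_pos hk
  -- With `max R 0` the origin is always an admissible point, which gives `f ≠ 0` even for negative
  -- `R`.
  let f : L2HalfSpace := indicatorConstLp 2 (measurableSet_scaleCylinder (max R 0 + r₀))
    (halfSpaceMeasure_scaleCylinder_ne_top _) (1 : ℝ)
  have hf : ∀ (n : ℕ) (x : Plane), ‖x‖ ≤ max R 0 →
      inner ℝ f (hk.memLp_scaleKernel 0 n x).toLp = I := fun n x hx => by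
    rw [L2.inner_indicatorConstLp_one]
    refine Eq.trans ?_ (setIntegral_scaleKernel hk n (x := x) (R := max R 0 + r₀) (by gcongr))
    exact integral_congr_ae (ae_restrict_of_ae (MemLp.coeFn_toLp _))
  have hf0 : 0 < ‖f‖ := by
    rw [norm_pos_iff]
    intro h0
    have := hf 0 0 (by simp)
    rw [h0, inner_zero_left] at this
    exact hI.ne this
  refine ⟨‖f‖⁻¹ • f, ‖f‖⁻¹ * I, ?_, by positivity, fun n x hx => ?_⟩
  · rw [norm_smul, norm_inv, norm_norm, inv_mul_cancel₀ hf0.ne']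
  · rw [real_inner_smul_left, hf n x (hx.trans (le_max_left _ _))]

/-! ### Shifting a Gaussian factor -/

theorem gaussianReal_two_le_abs_le : gaussianReal 0 1 {z | 2 ≤ |z|} ≤ 1 / 4 := by
  have h := meas_ge_le_variance_div_sq (memLp_id_gaussianReal (μ := 0) (v := 1) 2) two_pos
  simp only [variance_id_gaussianReal, id_eq, integral_id_gaussianReal, sub_zero] at h
  refine h.trans (le_of_eq ?_)
  rw [NNReal.coe_one, ENNReal.ofReal_div_of_pos (by norm_num)]
  norm_num

/-- A shift of the standard Gaussian measure by `s` loses at most a factor `e^{2 + s²}`, up to the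
Gaussian mass outside `[-2, 2]`. -/
theorem gaussianReal_le_mul_gaussianReal_add (s : ℝ) {B : Set ℝ} (hB : MeasurableSet B) :
    gaussianReal 0 1 B ≤
      ENNReal.ofReal (Real.exp (2 + s ^ 2)) * gaussianReal s 1 B + 1 / 4 := by
  have hI : MeasurableSet {z : ℝ | 2 ≤ |z|} := measurableSet_le (by fun_prop) (by fun_prop)
  rw [← measure_inter_add_sdiff B hI, add_comm]
  refine add_le_add ?_ ((measure_mono inter_subset_right).trans gaussianReal_two_le_abs_le)
  refine le_trans ?_ (mul_le_mul_right (measure_mono (sdiff_subset (t := {z : ℝ | 2 ≤ |z|}))) _)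
  rw [gaussianReal_apply _ one_ne_zero, gaussianReal_apply _ one_ne_zero,
    ← lintegral_const_mul _ (measurable_gaussianPDF _ _)]
  refine setLIntegral_mono' (hB.diff hI) fun z hz => ?_
  have hz2 : |z| < 2 := not_le.mp hz.2
  rw [gaussianPDF, gaussianPDF, ← ENNReal.ofReal_mul (Real.exp_pos _).le]
  refine ENNReal.ofReal_le_ofReal ?_
  rw [gaussianPDFReal, gaussianPDFReal, mul_left_comm, ← Real.exp_add]
  gcongr
  obtain ⟨h1, h2⟩ := abs_lt.mp hz2
  simp only [NNReal.coe_one]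
  -- The exponent inequality is equivalent to `0 ≤ (z + s)² + (4 - z²)`.
  nlinarith [sq_nonneg (z + s), mul_pos (sub_pos.mpr h1) (sub_pos.mpr h2)]

/-- If `Z` is standard Gaussian and independent of `Y`, then shifting `Z` by `s` cannot reduce the
probability of an event of probability at least `1/2` by more than a factor `4 e^{2 + s²}`. -/
theorem le_measureReal_gaussian_shift {Ω : Type*} [MeasurableSpace Ω] {P : Measure Ω}
    [IsProbabilityMeasure P] {Z Y : Ω → ℝ} (hZ : AEMeasurable Z P) (hY : AEMeasurable Y P)
    (hZlaw : P.map Z = gaussianReal 0 1) (hZY : IndepFun Z Y P) {A : Set (ℝ × ℝ)}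
    (hA : MeasurableSet A) (hPA : 1 / 2 ≤ P {ω | (Z ω, Y ω) ∈ A}) (s : ℝ) :
    Real.exp (-(2 + s ^ 2)) / 4 ≤ P.real {ω | (Z ω + s, Y ω) ∈ A} := by
  have hνp : IsProbabilityMeasure (P.map Y) := Measure.isProbabilityMeasure_map hY
  have hlaw : P.map (fun ω => (Z ω, Y ω)) = (gaussianReal 0 1).prod (P.map Y) := by
    rw [← hZlaw]
    exact (indepFun_iff_map_prod_eq_prod_map_map hZ hY).mp hZY
  have hshift : MeasurePreserving (fun z : ℝ => z + s) (gaussianReal 0 1) (gaussianReal s 1) :=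
    ⟨by fun_prop, by simp [gaussianReal_map_add_const]⟩
  have hlaw' : P.map (fun ω => (Z ω + s, Y ω)) = (gaussianReal s 1).prod (P.map Y) := by
    rw [← (hshift.prod (MeasurePreserving.id (P.map Y))).map_eq, ← hlaw,
      AEMeasurable.map_map_of_aemeasurable (by fun_prop) (hZ.prodMk hY)]
    rfl
  have h1 : P {ω | (Z ω, Y ω) ∈ A} = (gaussianReal 0 1).prod (P.map Y) A := by
    rw [← hlaw, Measure.map_apply_of_aemeasurable (hZ.prodMk hY) hA]; rfl
  have h2 : P {ω | (Z ω + s, Y ω) ∈ A} = (gaussianReal s 1).prod (P.map Y) A := by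
    rw [← hlaw', Measure.map_apply_of_aemeasurable ((hZ.add_const s).prodMk hY) hA]; rfl
  -- By independence the one-dimensional shift bound can be integrated over the slices of `A` at
  -- fixed `Y`.
  have h3 : P {ω | (Z ω, Y ω) ∈ A} ≤
      ENNReal.ofReal (Real.exp (2 + s ^ 2)) * P {ω | (Z ω + s, Y ω) ∈ A} + 1 / 4 := by
    rw [h1, h2, Measure.prod_apply_symm hA, Measure.prod_apply_symm hA,
      ← lintegral_const_mul _ (measurable_measure_prodMk_right hA)]
    calc _ ≤ ∫⁻ y, (ENNReal.ofReal (Real.exp (2 + s ^ 2)) *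
          gaussianReal s 1 ((fun x => (x, y)) ⁻¹' A) + 1 / 4) ∂(P.map Y) :=
        lintegral_mono fun y => gaussianReal_le_mul_gaussianReal_add s
          (measurable_prodMk_right hA)
      _ = _ := by rw [lintegral_add_right _ measurable_const]; simp
  have h4 := ENNReal.toReal_mono (by finiteness) (hPA.trans h3)
  rw [ENNReal.toReal_add (by finiteness) (by finiteness), ENNReal.toReal_mul,
    ENNReal.toReal_ofReal (Real.exp_pos _).le] at h4
  norm_num at h4
  rw [Real.exp_neg, div_le_iff₀ four_pos, inv_le_iff_one_le_mul₀ (Real.exp_pos _)]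
  rw [measureReal_def]
  linarith

/-! ### Medians -/

section Median

variable {Ω : Type*} [MeasurableSpace Ω] {P : Measure Ω} [IsProbabilityMeasure P] {X : Ω → ℝ}

/-- Right continuity of the distribution function along levels decreasing to the infimum. -/
theorem half_le_measure_le_median (hX : AEMeasurable X P) :
    1 / 2 ≤ P {ω | X ω ≤ median P X} := by
  set S := {l : ℝ | 0 ≤ l ∧ 1 / 2 < P.real {ω | X ω ≤ l}}
  have hne : S.Nonempty := by
    have hmono : Monotone fun n : ℕ => {ω | X ω ≤ n} := fun i j hij ω (hω : X ω ≤ i) =>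
      hω.trans (by exact_mod_cast hij)
    have huniv : ⋃ n : ℕ, {ω | X ω ≤ n} = univ :=
      eq_univ_of_forall fun ω => mem_iUnion.mpr (exists_nat_ge (X ω))
    have ht := tendsto_measure_iUnion_atTop (μ := P) hmono
    rw [huniv, measure_univ] at ht
    obtain ⟨n, hn⟩ := (ht.eventually (lt_mem_nhds (b := 1) (a := 1 / 2) (by norm_num))).exists
    refine ⟨n, n.cast_nonneg, ?_⟩
    have := (ENNReal.toReal_lt_toReal (by norm_num) (measure_ne_top _ _)).mpr hn
    simpa [measureReal_def] using this
  obtain ⟨u, hu_anti, hu_lim, hu_mem⟩ := exists_seq_tendsto_sInf hne ⟨0, fun l hl => hl.1⟩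
  have hInter : {ω | X ω ≤ median P X} = ⋂ n, {ω | X ω ≤ u n} := by
    ext ω
    simp only [mem_ofPred_eq, mem_iInter]
    exact ⟨fun h n => h.trans (hu_anti.le_of_tendsto hu_lim n), fun h => ge_of_tendsto' hu_lim h⟩
  have ht := tendsto_measure_iInter_atTop (μ := P) (s := fun n => {ω | X ω ≤ u n})
    (fun n => nullMeasurableSet_le hX aemeasurable_const)
    (fun i j hij ω (hω : X ω ≤ u j) => hω.trans (hu_anti hij)) ⟨0, measure_ne_top _ _⟩
  rw [hInter]
  refine ge_of_tendsto' ht fun n => ?_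
  have := (hu_mem n).2.le
  rw [measureReal_def] at this
  refine (ENNReal.toReal_le_toReal (by norm_num) (measure_ne_top _ _)).mp ?_
  simpa using this

theorem half_le_measure_median_le (hX : AEMeasurable X P) (hX0 : ∀ ω, 0 ≤ X ω) :
    1 / 2 ≤ P {ω | median P X ≤ X ω} := by
  have hsmall : ∀ l < median P X, P {ω | X ω ≤ l} ≤ 1 / 2 := fun l hl => by
    -- Negative levels are excluded from the set defining the median, so they need `X ≥ 0`.
    rcases lt_or_ge l 0 with h0 | h0
    · have : {ω | X ω ≤ l} = ∅ :=
        eq_empty_of_forall_notMem fun ω hω => absurd (h0.trans_le (hX0 ω)) (not_lt.mpr hω)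
      simp [this]
    · have := notMem_of_lt_csInf hl ⟨0, fun l hl => hl.1⟩
      have h1 : P.real {ω | X ω ≤ l} ≤ 1 / 2 := not_lt.mp fun h => this ⟨h0, h⟩
      rw [← ENNReal.toReal_le_toReal (by finiteness) (by norm_num)]
      simpa [measureReal_def] using h1
  obtain ⟨u, hu_mono, hu_lt, hu_lim⟩ := exists_seq_strictMono_tendsto (median P X)
  have hUnion : {ω | X ω < median P X} = ⋃ n, {ω | X ω ≤ u n} := by
    ext ω
    simp only [mem_ofPred_eq, mem_iUnion]
    exact ⟨fun h => ((hu_lim.eventually (lt_mem_nhds h)).exists).imp fun n hn => hn.le,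
      fun ⟨n, hn⟩ => hn.trans_lt (hu_lt n)⟩
  have ht := tendsto_measure_iUnion_atTop (μ := P) (s := fun n => {ω | X ω ≤ u n})
    fun i j hij ω (hω : X ω ≤ u i) => hω.trans (hu_mono.monotone hij)
  rw [← hUnion] at ht
  have hlt : P {ω | X ω < median P X} ≤ 1 / 2 := le_of_tendsto' ht fun n => hsmall _ (hu_lt n)
  have hcompl : {ω | median P X ≤ X ω} = {ω | X ω < median P X}ᶜ := by ext; simp
  rw [hcompl, prob_compl_eq_one_sub₀ (nullMeasurableSet_lt hX aemeasurable_const)]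
  refine le_trans (le_of_eq ?_) (tsub_le_tsub_left hlt 1)
  simp

end Median

/-! ### Splitting off an independent Gaussian factor -/

theorem covariance_congr_right {Ω : Type*} [MeasurableSpace Ω] {P : Measure Ω} {X Y Y' : Ω → ℝ}
    (h : Y =ᵐ[P] Y') : cov[X, Y; P] = cov[X, Y'; P] := by
  rw [covariance, covariance, integral_congr_ae h]
  refine integral_congr_ae ?_
  filter_upwards [h] with ω hω
  rw [hω]

theorem norm_le_two_of_mem_rectangle_one_one {x : Plane} (hx : x ∈ rectangle 1 1) : ‖x‖ ≤ 2 := by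
  obtain ⟨⟨h1, h2⟩, h3, h4⟩ := hx
  rw [EuclideanSpace.norm_eq, Real.sqrt_le_left (by norm_num)]
  simp only [Fin.sum_univ_two, Real.norm_eq_abs, sq_abs]
  nlinarith

/-- The left-right length is, almost surely, the exponential of a multiple of a standard Gaussian
variable times an independent random variable, where the multiple depends neither on `n` nor on
the white noise. -/
theorem exists_leftRightLength_factorization {k : Plane → ℝ} {r₀ : ℝ} (hk : IsBumpFunction k r₀)
    {γ : ℝ} (hγ : 0 < γ) :
    ∃ σ : ℝ, 0 < σ ∧ ∀ (Ω : Type*) [MeasurableSpace Ω] (P : Measure Ω) [IsProbabilityMeasure P]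
      (ξ : L2HalfSpace →ₗ[ℝ] Lp ℝ 2 P), IsWhiteNoise P ξ →
      ∀ (n : ℕ) (φ : Plane → Ω → ℝ), IsScaleField hk ξ 0 n φ →
      ∃ Z Y : Ω → ℝ, AEMeasurable Z P ∧ AEMeasurable Y P ∧ P.map Z = gaussianReal 0 1 ∧
        IndepFun Z Y P ∧
        ∀ᵐ ω ∂P, leftRightLength γ 1 1 (fun z => φ z ω) = Real.exp (σ * Z ω) * Y ω := by
  obtain ⟨g, a, hg, ha, hga⟩ := exists_unit_inner_scaleKernel hk 2
  refine ⟨γ / 2 * a, by positivity, fun Ω _ P _ ξ hξ n φ hφ => ?_⟩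
  borelize C(rectangle 1 1, ℝ)
  classical
  set Z : Ω → ℝ := fun ω => ξ g ω with hZdef
  have hZ : AEMeasurable Z P := IsWhiteNoise.aemeasurable ξ g
  -- The value 0 at discontinuous paths matters only on a null set.
  let X : Ω → C(rectangle 1 1, ℝ) := fun ω =>
    if h : Continuous fun x => φ x ω then
      ⟨fun z => φ z ω - a * Z ω, (h.comp continuous_subtype_val).sub continuous_const⟩ else 0
  have hX : ∀ᵐ ω ∂P, ∀ z, X ω z = φ z ω - a * Z ω := by
    filter_upwards [hφ.continuous_paths] with ω hω z
    simp [X, dif_pos hω]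
  -- Each `X z` is the pairing with the component of the kernel orthogonal to `g`: the inner product
  -- is `a - a ‖g‖² = 0`.
  let κ : rectangle 1 1 → L2HalfSpace := fun z => (hk.memLp_scaleKernel 0 n z).toLp - a • g
  have hXκ : ∀ z, ξ (κ z) =ᵐ[P] fun ω => X ω z := fun z => by
    rw [map_sub, map_smul]
    filter_upwards [hX, hφ.ae_eq z, Lp.coeFn_sub (ξ (hk.memLp_scaleKernel 0 n z).toLp) (a • ξ g),
      Lp.coeFn_smul a (ξ g)] with ω h1 h2 h3 h4
    rw [h1, h2, h3, Pi.sub_apply, h4, Pi.smul_apply, smul_eq_mul]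
  have hXm : ∀ z, AEMeasurable (fun ω => X ω z) P := fun z =>
    (IsWhiteNoise.aemeasurable ξ (κ z)).congr (hXκ z)
  have hproc : IsGaussianProcess (Sum.elim (fun _ : Unit => Z) fun z ω => X ω z) P :=
    (hξ.isGaussianProcess.comp_right (Sum.elim (fun _ : Unit => g) κ)).congr fun t =>
      match t with
      | .inl _ => Filter.EventuallyEq.rfl
      | .inr z => hXκ z
  have hcov : ∀ (s : Unit) (z : rectangle 1 1), cov[Z, fun ω => X ω z; P] = 0 := fun _ z => by
    rw [← covariance_congr_right (hXκ z), hξ.covariance_eq_inner, inner_sub_right,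
      hga n z (norm_le_two_of_mem_rectangle_one_one z.2), real_inner_smul_right,
      real_inner_self_eq_norm_sq, hg]
    ring
  have heval : Measurable fun u : Unit → ℝ => u () := measurable_pi_apply ()
  have hindep : IndepFun Z X P := ContinuousMap.indepFun_of_indepFun_eval
    ((hproc.indepFun_of_covariance_eq_zero (fun _ => hZ) hXm hcov).comp heval measurable_id)
  have hΛ := (continuous_leftRightLength_extendRectangle hγ.le 1 1).measurable
  refine ⟨Z, fun ω => leftRightLength γ 1 1 (extendRectangle (X ω)), hZ,
    hΛ.comp_aemeasurable (ContinuousMap.aemeasurable_of_aemeasurable_eval hXm), ?_,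
    hindep.comp measurable_id hΛ, ?_⟩
  · rw [hZdef, hξ.map_eq_gaussianReal]
    congr
    ext
    simp [hg]
  · filter_upwards [hX, hφ.continuous_paths] with ω h1 h2
    rw [mul_assoc]
    refine leftRightLength_eq_of_eq_add hγ.le h2.continuousOn
      (continuousOn_extendRectangle (X ω)) fun z hz => ?_
    rw [extendRectangle_of_mem _ hz, h1]
    ring

theorem mainTheorem6 (k : Plane → ℝ) (r₀ : ℝ) (hk : IsBumpFunction k r₀) (γ : ℝ) (hγ : 0 < γ) :
    ∃ c C : ℝ, 0 < c ∧ 0 < C ∧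
      ∀ (Ω : Type*) [MeasurableSpace Ω] (P : Measure Ω) [IsProbabilityMeasure P]
        (ξ : L2HalfSpace →ₗ[ℝ] Lp ℝ 2 P), IsWhiteNoise P ξ →
      ∀ (n : ℕ) (φ : Plane → Ω → ℝ), IsScaleField hk ξ 0 n φ →
      ∀ L : Ω → ℝ, (∀ ω, L ω = leftRightLength γ 1 1 fun z => φ z ω) →
      ∀ x : ℝ, 0 < x →
        c * Real.exp (-C * x ^ 2) ≤ P.real {ω | L ω ≤ median P L * Real.exp (-x)} ∧
        c * Real.exp (-C * x ^ 2) ≤ P.real {ω | median P L * Real.exp x ≤ L ω} := by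
  obtain ⟨σ, hσ, H⟩ := exists_leftRightLength_factorization hk hγ
  -- These constants are `e^{-(2 + s²)} / 4` read off at `s = ±x/σ`.
  refine ⟨Real.exp (-2) / 4, (σ ^ 2)⁻¹, by positivity, by positivity,
    fun Ω _ P _ ξ hξ n φ hφ L hL x _ => ?_⟩
  obtain ⟨Z, Y, hZ, hY, hZlaw, hZY, hfac⟩ := H Ω P ξ hξ n φ hφ
  have hLfac : ∀ᵐ ω ∂P, L ω = Real.exp (σ * Z ω) * Y ω := by
    filter_upwards [hfac] with ω hω
    rw [hL, hω]
  have hLm : AEMeasurable L P :=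
    ((Real.measurable_exp.comp_aemeasurable (hZ.const_mul σ)).mul hY).congr
      (hLfac.mono fun _ h => h.symm)
  have hL0 : ∀ ω, 0 ≤ L ω := fun ω => hL ω ▸ leftRightLength_nonneg _ _ _ _
  have hconst : ∀ s : ℝ, s ^ 2 = x ^ 2 / σ ^ 2 → Real.exp (-2) / 4 *
      Real.exp (-(σ ^ 2)⁻¹ * x ^ 2) = Real.exp (-(2 + s ^ 2)) / 4 := fun s hs => by
    rw [hs, neg_add, Real.exp_add]
    ring_nf
  have hF : Measurable fun p : ℝ × ℝ => Real.exp (σ * p.1) * p.2 := by fun_prop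
  set m := median P L
  constructor
  · have hPA : 1 / 2 ≤ P {ω | (Z ω, Y ω) ∈ {p : ℝ × ℝ | Real.exp (σ * p.1) * p.2 ≤ m}} := by
      refine (half_le_measure_le_median hLm).trans (measure_mono_ae ?_)
      filter_upwards [hLfac] with ω hω hle
      exact hω.symm.trans_le hle
    rw [hconst (x / σ) (by ring)]
    refine (le_measureReal_gaussian_shift hZ hY hZlaw hZY (measurableSet_le hF measurable_const)
      hPA (x / σ)).trans (ENNReal.toReal_mono (measure_ne_top _ _) (measure_mono_ae ?_))
    filter_upwards [hLfac] with ω hω (hle : Real.exp (σ * (Z ω + x / σ)) * Y ω ≤ m)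
    rw [mul_add, mul_div_cancel₀ _ hσ.ne', Real.exp_add] at hle
    change L ω ≤ m * Real.exp (-x)
    rw [hω, Real.exp_neg, ← div_eq_mul_inv, le_div_iff₀ (Real.exp_pos _)]
    linarith
  · have hPA : 1 / 2 ≤ P {ω | (Z ω, Y ω) ∈ {p : ℝ × ℝ | m ≤ Real.exp (σ * p.1) * p.2}} := by
      refine (half_le_measure_median_le hLm hL0).trans (measure_mono_ae ?_)
      filter_upwards [hLfac] with ω hω hle
      exact LE.le.trans_eq hle hω
    rw [hconst (-(x / σ)) (by ring)]
    refine (le_measureReal_gaussian_shift hZ hY hZlaw hZY (measurableSet_le measurable_const hF)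
      hPA (-(x / σ))).trans (ENNReal.toReal_mono (measure_ne_top _ _) (measure_mono_ae ?_))
    filter_upwards [hLfac] with ω hω (hle : m ≤ Real.exp (σ * (Z ω + -(x / σ))) * Y ω)
    rw [mul_add, mul_neg, mul_div_cancel₀ _ hσ.ne', Real.exp_add, Real.exp_neg, mul_right_comm,
      ← div_eq_mul_inv, le_div_iff₀ (Real.exp_pos _)] at hle
    change m * Real.exp x ≤ L ω
    rwa [hω]
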